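/- Let $\Omega\subset\mathbb{R}^n$ be a domain (a nonempty connected open set), let $A\le 2$, and let $G$ be a smooth real function on an open set $J\subset\mathbb{R}$ (for instance $J=\mathbb{R}$) such that $G>0$, $G'<0$ and $GG''\le A(G')^2$ on $J$. Let $u:\Omega\to J$ be a smooth convex solution of $\Delta u=G(u)$ in $\Omega$, where convex means convex along every line segment contained in $\Omega$. Let $\sigma_2(D^2u)$ denote the second elementary symmetric polynomial of the eigenvalues of the Hessian matrix $D^2u$. If $\sigma_2(D^2u)$ has a local minimum at some point of $\Omega$, then $D^2u$ has rank $1$ at every point of $\Omega$. -/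

import Mathlib

open Set
open scoped ContDiff Laplacian

noncomputable section

/-- The Hessian matrix `D²u(x) = (∂ᵢ∂ⱼu(x))` in the standard coordinates of `ℝⁿ`. -/
def hessianMatrix {n : ℕ} (u : EuclideanSpace ℝ (Fin n) → ℝ) (x : EuclideanSpace ℝ (Fin n)) :
    Matrix (Fin n) (Fin n) ℝ :=
  Matrix.of fun i j =>
    iteratedFDeriv ℝ 2 u x ![EuclideanSpace.single i (1 : ℝ), EuclideanSpace.single j (1 : ℝ)]

/-- `σ_k(M)`: the `k`-th elementary symmetric polynomial of the eigenvalues of the real symmetric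
matrix `M`. The multiset of roots of the characteristic polynomial is the multiset of the
eigenvalues with their multiplicities. -/
def sigmaK {n : ℕ} (k : ℕ) (M : Matrix (Fin n) (Fin n) ℝ) : ℝ :=
  M.charpoly.roots.esymm k

/-- `u` is a convex function on the (not necessarily convex) set `Ω`: it is convex on every convex
subset of `Ω`, equivalently along every segment contained in `Ω`. For convex `Ω` this is
`ConvexOn ℝ Ω u`. -/
def IsConvexFunctionOn {n : ℕ} (Ω : Set (EuclideanSpace ℝ (Fin n)))
    (u : EuclideanSpace ℝ (Fin n) → ℝ) : Prop :=
  ∀ K : Set (EuclideanSpace ℝ (Fin n)), K ⊆ Ω → Convex ℝ K → ConvexOn ℝ K u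

end

/-!
Write `F = σ₂(D²u)` and `h = G(u) = Δu`. In every orthonormal basis `F = (h² - |D²u|²) / 2`, so in
an eigenbasis of `D²u` at a point, with eigenvalues `λᵢ ≥ 0` of sum `S = h`, differentiating twice
gives
`ΔF = 2 G' F + ∑ₘ (G'² + G'' (S - λₘ)) uₘ² - |D³u|²`.
The structure condition with `A ≤ 2` bounds the middle sum by `∑ₘ (G' uₘ)² (3 - 2 λₘ / S)`. The
gradient of `F` gives `∑ᵢ λᵢ u_{iim} = S G' uₘ - Fₘ`, so by Cauchy-Schwarz the third derivatives
with index pattern `iim` already absorb that sum, up to an error controlled by `|∇F|`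
(`sum_diag_sq_le_sum_sq`, `weighted_sum_sq_lower_bound`). The outcome
(`laplacian_half_sq_sub_hessian_sq_le`) is
`ΔF ≤ 2 G' F + c |∇F|` on `Ω`, with `c` locally bounded.

Since `G' < 0`, a local minimum at which `F > 0` is impossible; so `F` vanishes at the local
minimum. As `F ≥ 0` satisfies `ΔF ≤ c |∇F|`, Hopf's strong minimum principle
(`eventually_eq_zero_of_laplacian_le`) makes the zero set of `F` open in `Ω`, and it is closed in
`Ω` by continuity, hence all of `Ω`. A positive semidefinite matrix with positive trace and
vanishing `σ₂` has rank one (`rank_hessianMatrix_eq_one`).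
-/

/-! ### Elementary symmetric polynomials and orthonormal bases -/

/-- Newton's identity `2σ₂ = p₁² - p₂`. -/
theorem Multiset.two_mul_esymm_two (s : Multiset ℝ) :
    2 * s.esymm 2 = s.sum ^ 2 - (s.map (fun a => a ^ 2)).sum := by
  induction s using Multiset.induction_on with
  | empty => simp [Multiset.esymm, Multiset.powersetCard_zero_right]
  | cons a s ih =>
    have h : (a ::ₘ s).esymm 2 = s.esymm 2 + a * s.sum := by
      have hs : (s.map (fun x => a * x)).sum = a * s.sum := by
        simpa using Multiset.sum_map_mul_left (s := s) (a := a) (f := id)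
      simp [Multiset.esymm, Multiset.powersetCard_cons, Multiset.powersetCard_one, hs]
    rw [h, Multiset.sum_cons, Multiset.map_cons, Multiset.sum_cons]
    linarith

theorem Matrix.IsHermitian.two_mul_sigmaK_two {n : ℕ} {M : Matrix (Fin n) (Fin n) ℝ}
    (hM : M.IsHermitian) :
    2 * sigmaK 2 M = (∑ i, hM.eigenvalues i) ^ 2 - ∑ i, hM.eigenvalues i ^ 2 := by
  rw [sigmaK, Multiset.two_mul_esymm_two, hM.roots_charpoly_eq_eigenvalues]
  rw [Multiset.map_map]
  rfl

section

variable {E ι κ : Type*} [NormedAddCommGroup E] [InnerProductSpace ℝ E] [CompleteSpace E]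
  [Fintype ι] [Fintype κ]

theorem OrthonormalBasis.sum_sq_clm_apply (b : OrthonormalBasis ι ℝ E) (L : E →L[ℝ] ℝ) :
    ∑ i, (L (b i)) ^ 2 = ‖L‖ ^ 2 := by
  have h := b.sum_sq_norm_inner_left ((InnerProductSpace.toDual ℝ E).symm L)
  simpa using h

/-- The Frobenius norm of a symmetric bilinear form does not depend on the orthonormal basis. -/
theorem OrthonormalBasis.sum_sq_bilin_eq (b : OrthonormalBasis ι ℝ E) (c : OrthonormalBasis κ ℝ E)
    (B : E →L[ℝ] E →L[ℝ] ℝ) (hB : ∀ v w, B v w = B w v) :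
    ∑ i, ∑ j, (B (b i) (b j)) ^ 2 = ∑ i, ∑ j, (B (c i) (c j)) ^ 2 := by
  simp_rw [OrthonormalBasis.sum_sq_clm_apply]
  simp_rw [← c.sum_sq_clm_apply (B (b _)), ← b.sum_sq_clm_apply (B (c _))]
  rw [Finset.sum_comm]
  simp_rw [hB (b _) (c _)]

end

/-- If the matrix `M` represents the bilinear form `B` in the standard basis, then an orthonormal
eigenbasis of `M` diagonalizes `B`. -/
theorem Matrix.IsHermitian.bilin_eigenvectorBasis {n : ℕ} {M : Matrix (Fin n) (Fin n) ℝ}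
    (hM : M.IsHermitian)
    (B : EuclideanSpace ℝ (Fin n) →L[ℝ] EuclideanSpace ℝ (Fin n) →L[ℝ] ℝ)
    (hB : ∀ i j, M i j = B (EuclideanSpace.single i 1) (EuclideanSpace.single j 1)) (i j : Fin n) :
    B (hM.eigenvectorBasis i) (hM.eigenvectorBasis j) =
      if i = j then hM.eigenvalues i else 0 := by
  have key : ∀ v w : EuclideanSpace ℝ (Fin n),
      B v w = (v : Fin n → ℝ) ⬝ᵥ (M.mulVec (w : Fin n → ℝ)) := by
    intro v w
    have hv : ∀ v : EuclideanSpace ℝ (Fin n), v = ∑ i, v i • EuclideanSpace.single i (1 : ℝ) := by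
      intro v
      have := (EuclideanSpace.basisFun (Fin n) ℝ).sum_repr v
      simpa using this.symm
    conv_lhs => rw [hv v, hv w]
    simp only [map_sum, map_smul, _root_.sum_apply, _root_.smul_apply,
      smul_eq_mul, ← hB, dotProduct, Matrix.mulVec, Finset.mul_sum]
    rw [Finset.sum_comm]
    refine Finset.sum_congr rfl fun a _ => Finset.sum_congr rfl fun c _ => ?_
    ring
  rw [key, hM.mulVec_eigenvectorBasis]
  have h := orthonormal_iff_ite.1 hM.eigenvectorBasis.orthonormal i j
  rw [EuclideanSpace.inner_eq_star_dotProduct] at h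
  simp only [star_trivial] at h
  rw [dotProduct_smul, dotProduct_comm, smul_eq_mul, h]
  split_ifs with hij
  · rw [hij, mul_one]
  · simp

/-! ### The pointwise algebraic inequality -/

section

variable {ι : Type*} [Fintype ι] [DecidableEq ι]

/-- A lower bound for the squared norm of a symmetric 3-tensor, discarding the entries with three
distinct indices: an entry with pattern `iim` occurs three times if `i ≠ m`, and once if `i = m`. -/
theorem sum_diag_sq_le_sum_sq (T : ι → ι → ι → ℝ) (h₁ : ∀ i j k, T i j k = T j i k)
    (h₂ : ∀ i j k, T i j k = T i k j) :
    ∑ m, (3 * ∑ i, T i i m ^ 2 - 2 * T m m m ^ 2) ≤ ∑ i, ∑ j, ∑ k, T i j k ^ 2 := by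
  have hpt : ∀ i j k, (if i = j then T i j k ^ 2 else 0) + (if j = k then T i j k ^ 2 else 0)
      + (if i = k then T i j k ^ 2 else 0)
      - 2 * (if i = j then (if j = k then T i j k ^ 2 else 0) else 0) ≤ T i j k ^ 2 := by
    intro i j k
    have := sq_nonneg (T i j k)
    by_cases hij : i = j
    · subst hij
      by_cases hik : i = k
      · simp [hik]; linarith
      · simp [hik]
    · by_cases hjk : j = k
      · subst hjk; simp [hij]
      · by_cases hik : i = k
        · subst hik
          simp [hij, hjk]
        · simpa [hij, hjk, hik] using this
  refine le_trans (le_of_eq ?_) (Finset.sum_le_sum fun i _ => Finset.sum_le_sum fun j _ =>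
    Finset.sum_le_sum fun k _ => hpt i j k)
  simp only [Finset.sum_sub_distrib, Finset.sum_add_distrib, ← Finset.mul_sum]
  have e1 : ∑ i, ∑ j, ∑ k, (if i = j then T i j k ^ 2 else 0) = ∑ m, ∑ i, T i i m ^ 2 := by
    rw [Finset.sum_comm' (t' := Finset.univ) (s' := fun _ => Finset.univ) (by simp)]
    rw [Finset.sum_comm (γ := ι) (s := Finset.univ) (t := Finset.univ)
      (f := fun m i => T i i m ^ 2)]
    refine Finset.sum_congr rfl fun j _ => ?_
    rw [Finset.sum_comm]
    simp
  have e2 : ∑ i, ∑ j, ∑ k, (if j = k then T i j k ^ 2 else 0) = ∑ m, ∑ i, T i i m ^ 2 := by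
    refine Finset.sum_congr rfl fun m _ => Finset.sum_congr rfl fun i _ => ?_
    simp only [Finset.sum_ite_eq, Finset.mem_univ, if_true]
    rw [h₁ m i i, h₂ i m i]
  have e3 : ∑ i, ∑ j, ∑ k, (if i = k then T i j k ^ 2 else 0) = ∑ m, ∑ i, T i i m ^ 2 := by
    rw [Finset.sum_comm]
    refine Finset.sum_congr rfl fun m _ => Finset.sum_congr rfl fun i _ => ?_
    simp [h₂ i m i]
  have e4 : ∑ i, ∑ j, ∑ k, (if i = j then (if j = k then T i j k ^ 2 else 0) else 0)
      = ∑ m, T m m m ^ 2 := by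
    refine Finset.sum_congr rfl fun m _ => ?_
    rw [Finset.sum_comm]
    simp
  rw [e1, e2, e3, e4]
  ring

/-- The estimate for the third derivatives `aᵢ = u_{iim}` with a fixed index `m`. Cauchy-Schwarz
bounds `(∑ λᵢ aᵢ)²` by `D · (a_m² + 3 ∑_{i ≠ m} aᵢ²)` with `D = λ_m² + (S - λ_m)² / 3`, and
`S³ - D (3S - 2λ_m) = 8 λ_m (S - λ_m)² / 3` is nonnegative. -/
theorem weighted_sum_sq_lower_bound (l a : ι → ℝ) (hl : ∀ i, 0 ≤ l i) (m : ι) (S t f : ℝ)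
    (hS : 0 < S) (hlS : ∑ i, l i = S) (hf : f = S * t - ∑ i, l i * a i) :
    t ^ 2 * (3 - 2 * l m / S) - 8 * |t| * |f| / S ≤ 3 * ∑ i, a i ^ 2 - 2 * a m ^ 2 := by
  set s := Finset.univ.erase m
  have spl : ∀ g : ι → ℝ, ∑ i, g i = g m + ∑ i ∈ s, g i := fun g =>
    (Finset.add_sum_erase _ g (Finset.mem_univ m)).symm
  rw [spl] at hlS
  rw [spl (fun i => l i * a i)] at hf
  rw [spl (fun i => a i ^ 2)]
  have hmu := hl m
  set μ := l m
  set N := ∑ i ∈ s, a i ^ 2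
  have hN : 0 ≤ N := Finset.sum_nonneg fun i _ => sq_nonneg _
  set P := ∑ i ∈ s, l i * a i
  have hR : ∑ i ∈ s, l i = S - μ := by linarith
  have hR0 : 0 ≤ S - μ := hR ▸ Finset.sum_nonneg fun i _ => hl i
  have hl2 : ∑ i ∈ s, l i ^ 2 ≤ (S - μ) ^ 2 := by
    rw [← hR]; exact Finset.sum_sq_le_sq_sum_of_nonneg fun i _ => hl i
  have hP : P ^ 2 ≤ (S - μ) ^ 2 * N :=
    (Finset.sum_mul_sq_le_sq_mul_sq s l a).trans (mul_le_mul_of_nonneg_right hl2 hN)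
  set D := μ ^ 2 + (S - μ) ^ 2 / 3 with hD
  set c := a m ^ 2 + 3 * N
  have hc : 0 ≤ c := by positivity
  have hDS : S ^ 2 / 4 ≤ D := by rw [hD]; nlinarith [sq_nonneg (S - 4 * μ)]
  have hD0 : 0 < D := lt_of_lt_of_le (by positivity) hDS
  -- Cauchy-Schwarz in the plane for the vectors `(μ, (S - μ)/√3)` and `(a m, √(3N))`
  have hCS : (μ * a m + P) ^ 2 ≤ D * c := by
    have hx : 2 * (μ * a m) * P ≤ μ ^ 2 * (3 * N) + a m ^ 2 * ((S - μ) ^ 2 / 3) := by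
      rcases eq_or_lt_of_le hN with h0 | h0
      · have : P = 0 := by
          have : P ^ 2 ≤ 0 := by simpa [← h0] using hP
          exact pow_eq_zero_iff (two_ne_zero) |>.1 (le_antisymm this (sq_nonneg _))
        rw [this, ← h0]; simp; positivity
      · have h1 : 0 ≤ (3 * N * μ - a m * P) ^ 2 := sq_nonneg _
        have h2 : a m ^ 2 * P ^ 2 ≤ a m ^ 2 * ((S - μ) ^ 2 * N) :=
          mul_le_mul_of_nonneg_left hP (sq_nonneg _)
        have h3 : 0 ≤ N * (3 * (μ ^ 2 * (3 * N) + a m ^ 2 * ((S - μ) ^ 2 / 3)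
            - 2 * (μ * a m) * P)) := by nlinarith
        nlinarith [nonneg_of_mul_nonneg_right h3 h0]
    simp only [hD, c]
    nlinarith
  have hval : μ * a m + P = S * t - f := by linarith
  rw [hval] at hCS
  have hpoly : D * (3 * S - 2 * μ) ≤ S ^ 3 := by
    have : 0 ≤ 8 * μ * (S - μ) ^ 2 / 3 := by positivity
    have e : S ^ 3 - D * (3 * S - 2 * μ) = 8 * μ * (S - μ) ^ 2 / 3 := by rw [hD]; ring
    linarith
  have htf : t * f ≤ |t| * |f| := by rw [← abs_mul]; exact le_abs_self _
  have hgoal : t ^ 2 * (3 - 2 * μ / S) - 8 * |t| * |f| / S ≤ c := by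
    have hT : 0 ≤ |t| * |f| := by positivity
    have e1 : t ^ 2 * (3 - 2 * μ / S) - 8 * |t| * |f| / S
        = (t ^ 2 * (3 * S - 2 * μ) - 8 * (|t| * |f|)) / S := by field_simp
    rw [e1, div_le_iff₀ hS]
    by_contra! hlt
    have h1 := mul_lt_mul_of_pos_left hlt hD0
    have h2 := mul_le_mul_of_nonneg_left hpoly (sq_nonneg t)
    have h3 := mul_le_mul_of_nonneg_left hCS hS.le
    have h4 := mul_le_mul_of_nonneg_left hDS hT
    have h5 := mul_le_mul_of_nonneg_left htf (sq_nonneg S)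
    have h6 : 0 ≤ S * f ^ 2 := by positivity
    nlinarith
  calc _ ≤ c := hgoal
    _ = _ := by simp only [c]; ring

end

/-! ### Directional derivatives -/

section

open Filter Topology

variable {E : Type*} [NormedAddCommGroup E] [NormedSpace ℝ E] {Ω : Set E} {f g u : E → ℝ} {x : E}

/-- The directional derivative `∂ᵥ f`, as a function on the whole space; it takes the junk value
`0` where `f` is not differentiable. -/
noncomputable def dirDeriv (v : E) (f : E → ℝ) : E → ℝ := fun x => fderiv ℝ f x v

theorem ContDiffOn.differentiableAt_of_isOpen (hf : ContDiffOn ℝ ∞ f Ω) (hΩ : IsOpen Ω)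
    (hx : x ∈ Ω) : DifferentiableAt ℝ f x :=
  (hf.differentiableOn (by simp)).differentiableAt (hΩ.mem_nhds hx)

theorem ContDiffOn.dirDeriv (hf : ContDiffOn ℝ ∞ f Ω) (hΩ : IsOpen Ω) (v : E) :
    ContDiffOn ℝ ∞ (dirDeriv v f) Ω :=
  (hf.fderiv_of_isOpen hΩ (m := ∞) (by simp)).clm_apply contDiffOn_const

theorem Set.EqOn.dirDeriv (h : EqOn f g Ω) (hΩ : IsOpen Ω) (v : E) :
    EqOn (dirDeriv v f) (dirDeriv v g) Ω := fun x hx => by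
  have : f =ᶠ[𝓝 x] g := h.eventuallyEq_of_mem (hΩ.mem_nhds hx)
  simp only [_root_.dirDeriv, this.fderiv_eq]

theorem dirDeriv_sub (v : E) (hf : DifferentiableAt ℝ f x) (hg : DifferentiableAt ℝ g x) :
    dirDeriv v (fun y => f y - g y) x = dirDeriv v f x - dirDeriv v g x := by
  simp [dirDeriv, fderiv_fun_sub hf hg]

theorem dirDeriv_const_mul (v : E) (c : ℝ) (hf : DifferentiableAt ℝ f x) :
    dirDeriv v (fun y => c * f y) x = c * dirDeriv v f x := by
  simp [dirDeriv, fderiv_const_mul hf]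

theorem dirDeriv_mul (v : E) (hf : DifferentiableAt ℝ f x) (hg : DifferentiableAt ℝ g x) :
    dirDeriv v (fun y => f y * g y) x = dirDeriv v f x * g x + f x * dirDeriv v g x := by
  simp [dirDeriv, fderiv_fun_mul hf hg]
  ring

theorem dirDeriv_sum {ι : Type*} (s : Finset ι) (v : E) {f : ι → E → ℝ}
    (hf : ∀ i ∈ s, DifferentiableAt ℝ (f i) x) :
    dirDeriv v (fun y => ∑ i ∈ s, f i y) x = ∑ i ∈ s, dirDeriv v (f i) x := by
  simp [dirDeriv, fderiv_fun_sum hf]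

theorem dirDeriv_sq (v : E) (hf : DifferentiableAt ℝ f x) :
    dirDeriv v (fun y => f y ^ 2) x = 2 * (f x * dirDeriv v f x) := by
  simp_rw [pow_two]
  rw [dirDeriv_mul v hf hf]
  ring

theorem dirDeriv_comp (v : E) {G : ℝ → ℝ} (hG : DifferentiableAt ℝ G (u x))
    (hu : DifferentiableAt ℝ u x) :
    dirDeriv v (fun y => G (u y)) x = deriv G (u x) * dirDeriv v u x := by
  have h := (hG.hasDerivAt.comp_hasFDerivAt x hu.hasFDerivAt).fderiv
  have h' : fderiv ℝ (fun y => G (u y)) x = deriv G (u x) • fderiv ℝ u x := h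
  simp [dirDeriv, h']

theorem dirDeriv_dirDeriv_eq (hΩ : IsOpen Ω) (hf : ContDiffOn ℝ ∞ f Ω) (hx : x ∈ Ω) (v w : E) :
    dirDeriv v (dirDeriv w f) x = fderiv ℝ (fderiv ℝ f) x v w := by
  have h : DifferentiableAt ℝ (fderiv ℝ f) x :=
    ((hf.fderiv_of_isOpen hΩ (m := ∞) (by simp)).differentiableOn
      (by simp)).differentiableAt (hΩ.mem_nhds hx)
  have e : dirDeriv w f = fun y => (fderiv ℝ f y) w := rfl
  rw [dirDeriv, e, fderiv_clm_apply h (differentiableAt_const w)]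
  simp

theorem dirDeriv_comm (hΩ : IsOpen Ω) (hf : ContDiffOn ℝ ∞ f Ω) (v w : E) :
    EqOn (dirDeriv v (dirDeriv w f)) (dirDeriv w (dirDeriv v f)) Ω := fun x hx => by
  rw [dirDeriv_dirDeriv_eq hΩ hf hx, dirDeriv_dirDeriv_eq hΩ hf hx]
  exact ((hf.contDiffAt (hΩ.mem_nhds hx)).isSymmSndFDerivAt
    (by simpa using ENat.LEInfty.out)) v w

theorem hasDerivAt_line (v : E) {t : ℝ} (hf : DifferentiableAt ℝ f (x + t • v)) :
    HasDerivAt (fun s : ℝ => f (x + s • v)) (dirDeriv v f (x + t • v)) t := by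
  have h1 : HasDerivAt (fun s : ℝ => x + s • v) v t := by
    simpa using ((hasDerivAt_id t).smul_const v).const_add x
  exact hf.hasFDerivAt.comp_hasDerivAt t h1

theorem eventually_line_mem (hΩ : IsOpen Ω) (hx : x ∈ Ω) (v : E) :
    ∀ᶠ t : ℝ in 𝓝 0, x + t • v ∈ Ω := by
  have hc : Continuous fun t : ℝ => x + t • v := by fun_prop
  exact hc.continuousAt.eventually_mem (by simpa using hΩ.mem_nhds hx)

theorem deriv_line_eventuallyEq (hΩ : IsOpen Ω) (hf : ContDiffOn ℝ ∞ f Ω) (hx : x ∈ Ω) (v : E) :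
    deriv (fun t : ℝ => f (x + t • v)) =ᶠ[𝓝 0] fun t : ℝ => dirDeriv v f (x + t • v) := by
  filter_upwards [eventually_line_mem hΩ hx v] with t ht
  exact (hasDerivAt_line v (hf.differentiableAt_of_isOpen hΩ ht)).deriv

theorem deriv_deriv_line (hΩ : IsOpen Ω) (hf : ContDiffOn ℝ ∞ f Ω) (hx : x ∈ Ω) (v : E) :
    deriv (deriv fun t : ℝ => f (x + t • v)) 0 = dirDeriv v (dirDeriv v f) x := by
  rw [(deriv_line_eventuallyEq hΩ hf hx v).deriv_eq]
  have := (hasDerivAt_line (x := x) (t := 0) v (f := dirDeriv v f)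
    (by simpa using (hf.dirDeriv hΩ v).differentiableAt_of_isOpen hΩ hx)).deriv
  simpa using this

/-- The second-order necessary condition at a local minimum. -/
theorem IsLocalMin.dirDeriv_dirDeriv_nonneg (hΩ : IsOpen Ω) (hf : ContDiffOn ℝ ∞ f Ω)
    (hx : x ∈ Ω) (hmin : IsLocalMin f x) (v : E) : 0 ≤ dirDeriv v (dirDeriv v f) x := by
  by_contra! hneg
  rw [← deriv_deriv_line hΩ hf hx v] at hneg
  set g : ℝ → ℝ := fun t => f (x + t • v)
  have hc : Continuous fun t : ℝ => x + t • v := by fun_prop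
  have hx0 : x + (0 : ℝ) • v = x := by simp
  have hgmin : IsLocalMin g 0 := by
    have h : Tendsto (fun t : ℝ => x + t • v) (𝓝 0) (𝓝 x) := by
      simpa using hc.tendsto 0
    have := h.eventually hmin
    filter_upwards [this] with t ht
    simpa [g] using ht
  have hd := hgmin.deriv_eq_zero
  have hgc : ContinuousAt g 0 :=
    (hasDerivAt_line v (hx0.symm ▸ hf.differentiableAt_of_isOpen hΩ hx)).continuousAt
  have hgmax := isLocalMax_of_deriv_deriv_neg hneg hd hgc
  -- an extremum of both kinds forces `g` to be locally constant
  have hconst : g =ᶠ[𝓝 0] fun _ => g 0 := by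
    filter_upwards [hgmin, hgmax] with t h1 h2 using le_antisymm h2 h1
  have : deriv (deriv g) 0 = 0 := by
    have h2 : deriv g =ᶠ[𝓝 0] fun _ => 0 := by
      filter_upwards [hconst.deriv] with t ht
      simpa using ht
    simpa using h2.deriv_eq
  linarith

theorem ConvexOn.dirDeriv_dirDeriv_nonneg (hΩ : IsOpen Ω) (hf : ContDiffOn ℝ ∞ f Ω)
    (hconv : ConvexOn ℝ Ω f) (hx : x ∈ Ω) (v : E) : 0 ≤ dirDeriv v (dirDeriv v f) x := by
  rw [← deriv_deriv_line hΩ hf hx v]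
  set g : ℝ → ℝ := fun t => f (x + t • v)
  set S : Set ℝ := {t | x + t • v ∈ Ω}
  have hS : S ∈ 𝓝 (0 : ℝ) := eventually_line_mem hΩ hx v
  have hg : ConvexOn ℝ S g := by
    have := hconv.comp_affineMap (AffineMap.lineMap x (x + v))
    have e : ∀ t : ℝ, AffineMap.lineMap x (x + v) t = x + t • v := by
      intro t; simp [AffineMap.lineMap_apply, add_comm]
    simpa [Set.preimage, Function.comp_def, e] using this
  have hmono : MonotoneOn (deriv g) S := hg.monotoneOn_deriv fun t ht =>
    (hasDerivAt_line v (hf.differentiableAt_of_isOpen hΩ ht)).differentiableAt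
  rw [← derivWithin_of_mem_nhds hS]
  exact hmono.derivWithin_nonneg

end

theorem laplacian_eq_sum_dirDeriv {E ι : Type*} [NormedAddCommGroup E] [InnerProductSpace ℝ E]
    [FiniteDimensional ℝ E] [Fintype ι] {Ω : Set E} {f : E → ℝ} {x : E}
    (b : OrthonormalBasis ι ℝ E) (hΩ : IsOpen Ω) (hf : ContDiffOn ℝ ∞ f Ω) (hx : x ∈ Ω) :
    (Δ f) x = ∑ i, dirDeriv (b i) (dirDeriv (b i) f) x := by
  rw [congrFun (InnerProductSpace.laplacian_eq_iteratedFDeriv_orthonormalBasis f b) x]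
  refine Finset.sum_congr rfl fun i _ => ?_
  rw [dirDeriv_dirDeriv_eq hΩ hf hx, iteratedFDeriv_two_apply]
  simp

/-! ### The strong minimum principle -/

section

open Filter Topology

variable {E ι : Type*} [NormedAddCommGroup E] [InnerProductSpace ℝ E]

theorem contDiff_exp_neg_norm_sq (α : ℝ) (y : E) :
    ContDiff ℝ ∞ fun z : E => Real.exp (-α * ‖z - y‖ ^ 2) :=
  Real.contDiff_exp.comp (contDiff_const.mul ((contDiff_norm_sq ℝ).comp
    (contDiff_id.sub contDiff_const)))

theorem hasFDerivAt_exp_neg_norm_sq (α : ℝ) (y z : E) :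
    HasFDerivAt (fun z : E => Real.exp (-α * ‖z - y‖ ^ 2))
      ((-2 * α * Real.exp (-α * ‖z - y‖ ^ 2)) • innerSL ℝ (z - y)) z := by
  have h1 : HasFDerivAt (fun z : E => ‖z - y‖ ^ 2) (2 • innerSL ℝ (z - y)) z := by
    simpa using ((hasFDerivAt_id z).sub_const y).norm_sq
  refine (h1.const_mul (-α)).exp.congr_fderiv ?_
  ext v
  simp
  ring

theorem dirDeriv_exp_neg_norm_sq (α : ℝ) (y v : E) :
    dirDeriv v (fun z : E => Real.exp (-α * ‖z - y‖ ^ 2))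
      = fun z => -2 * α * (Real.exp (-α * ‖z - y‖ ^ 2) * inner ℝ (z - y) v) := by
  ext z
  rw [dirDeriv, (hasFDerivAt_exp_neg_norm_sq α y z).fderiv, smul_apply, innerSL_apply_apply,
    smul_eq_mul]
  ring

theorem dirDeriv_dirDeriv_exp_neg_norm_sq (α : ℝ) (y v z : E) :
    dirDeriv v (dirDeriv v (fun z : E => Real.exp (-α * ‖z - y‖ ^ 2))) z
      = Real.exp (-α * ‖z - y‖ ^ 2)
        * (4 * α ^ 2 * inner ℝ (z - y) v ^ 2 - 2 * α * ‖v‖ ^ 2) := by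
  have h1 := (hasFDerivAt_exp_neg_norm_sq α y z).differentiableAt
  have h2 : HasFDerivAt (fun z : E => inner ℝ (z - y) v) (innerSL ℝ v) z := by
    have h : HasFDerivAt (fun z : E => innerSL ℝ v (z - y)) (innerSL ℝ v) z :=
      (innerSL ℝ v).hasFDerivAt.comp z ((hasFDerivAt_id z).sub_const y)
    have he : (fun z : E => inner ℝ (z - y) v) = fun z => innerSL ℝ v (z - y) := by
      ext w
      rw [innerSL_apply_apply, real_inner_comm]
    rwa [he]
  rw [dirDeriv_exp_neg_norm_sq, dirDeriv_const_mul (f := fun z => Real.exp (-α * ‖z - y‖ ^ 2) *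
    inner ℝ (z - y) v) v _ (h1.mul h2.differentiableAt), dirDeriv_mul v h1 h2.differentiableAt,
    dirDeriv_exp_neg_norm_sq]
  simp only [dirDeriv, h2.fderiv, innerSL_apply_apply, real_inner_self_eq_norm_sq]
  ring

/-- The barrier `exp(-α|x - y|²)` satisfies `Δ e > C |∇ e|` away from its centre once `α` is large,
so at a local minimum of `f - ε (e - c)` the inequality `Δ f ≤ C |∇ f|` has to fail. -/
theorem not_isLocalMin_sub_barrier [FiniteDimensional ℝ E] [Fintype ι]
    (b : OrthonormalBasis ι ℝ E) {Ω : Set E} {f : E → ℝ} (hΩ : IsOpen Ω)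
    (hf : ContDiffOn ℝ ∞ f Ω) {C α ε c : ℝ} (hα : 0 < α) (hε : 0 < ε)
    {x y : E} (hx : x ∈ Ω) (hle : (Δ f) x ≤ C * ‖fderiv ℝ f x‖)
    (hbig : Fintype.card ι + C * ‖x - y‖ < 2 * α * ‖x - y‖ ^ 2) :
    ¬ IsLocalMin (fun z => f z - ε * (Real.exp (-α * ‖z - y‖ ^ 2) - c)) x := by
  intro hmin
  set e : E → ℝ := fun z => Real.exp (-α * ‖z - y‖ ^ 2) with he
  have hes : ContDiff ℝ ∞ e := contDiff_exp_neg_norm_sq α y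
  have hh : ContDiffOn ℝ ∞ (fun z => ε * (e z - c)) Ω :=
    (contDiff_const.mul (hes.sub contDiff_const)).contDiffOn
  have hd : ∀ z v, dirDeriv v (fun z => ε * (e z - c)) z = ε * dirDeriv v e z := by
    intro z v
    have hez : DifferentiableAt ℝ e z := (hasFDerivAt_exp_neg_norm_sq α y z).differentiableAt
    rw [dirDeriv_const_mul (f := fun z => e z - c) v ε (hez.sub_const c)]
    simp [dirDeriv, fderiv_sub_const]
  have hdd : ∀ v, dirDeriv v (dirDeriv v (fun z => ε * (e z - c))) x
      = ε * dirDeriv v (dirDeriv v e) x := by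
    intro v
    have : dirDeriv v (fun z => ε * (e z - c)) = fun z => ε * dirDeriv v e z := by
      ext z; exact hd z v
    rw [this, dirDeriv_const_mul]
    exact (hes.contDiffOn.dirDeriv isOpen_univ v).differentiableAt_of_isOpen isOpen_univ
      (mem_univ x)
  have hfx := hf.differentiableAt_of_isOpen hΩ hx
  have hhx := hh.differentiableAt_of_isOpen hΩ hx
  -- first-order condition
  have h1 : fderiv ℝ f x = (ε * (-2 * α * e x)) • innerSL ℝ (x - y) := by
    have h0 := hmin.fderiv_eq_zero
    have h0' : fderiv ℝ f x - fderiv ℝ (fun z => ε * (e z - c)) x = 0 := by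
      rw [← h0]; exact (fderiv_fun_sub hfx hhx).symm
    have h2 : fderiv ℝ (fun z => ε * (e z - c)) x = (ε * (-2 * α * e x)) • innerSL ℝ (x - y) := by
      refine HasFDerivAt.fderiv ?_
      rw [← smul_smul]
      exact ((hasFDerivAt_exp_neg_norm_sq α y x).sub_const c).const_mul ε
    rw [sub_eq_zero.1 h0', h2]
  have hex : 0 < e x := Real.exp_pos _
  have hnorm : ‖fderiv ℝ f x‖ = ε * (2 * α * e x) * ‖x - y‖ := by
    rw [h1, norm_smul, innerSL_apply_norm, Real.norm_eq_abs]
    have : ε * (-2 * α * e x) = -(ε * (2 * α * e x)) := by ring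
    rw [this, abs_neg, abs_of_pos (by positivity)]
  -- second-order condition
  have h2 : ∀ i, ε * (e x * (4 * α ^ 2 * inner ℝ (x - y) (b i) ^ 2 - 2 * α))
      ≤ dirDeriv (b i) (dirDeriv (b i) f) x := by
    intro i
    have hs := hmin.dirDeriv_dirDeriv_nonneg hΩ (hf.sub hh) hx (b i)
    have hE : EqOn (dirDeriv (b i) fun z => f z - ε * (e z - c))
        (fun z => dirDeriv (b i) f z - dirDeriv (b i) (fun z => ε * (e z - c)) z) Ω :=
      fun z hz => dirDeriv_sub _ (hf.differentiableAt_of_isOpen hΩ hz)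
        (hh.differentiableAt_of_isOpen hΩ hz)
    rw [hE.dirDeriv hΩ _ hx, dirDeriv_sub _ ((hf.dirDeriv hΩ _).differentiableAt_of_isOpen hΩ hx)
      ((hh.dirDeriv hΩ _).differentiableAt_of_isOpen hΩ hx), hdd,
      dirDeriv_dirDeriv_exp_neg_norm_sq, b.norm_eq_one] at hs
    simp only [he]
    linarith
  have h3 := Finset.sum_le_sum fun i (_ : i ∈ Finset.univ) => h2 i
  rw [← laplacian_eq_sum_dirDeriv b hΩ hf hx] at h3
  have h4 : ∑ i, inner ℝ (x - y) (b i) ^ 2 = ‖x - y‖ ^ 2 := by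
    simpa using b.sum_sq_norm_inner_left (x - y)
  rw [← Finset.mul_sum, ← Finset.mul_sum, Finset.sum_sub_distrib, ← Finset.mul_sum, h4,
    Finset.sum_const, Finset.card_univ, nsmul_eq_mul] at h3
  have h5 := h3.trans hle
  rw [hnorm] at h5
  have h6 : 0 < ε * e x * (2 * α) := by positivity
  have h7 := mul_lt_mul_of_pos_left hbig h6
  nlinarith

/-- The set where `f` vanishes is touched by a ball in which `f` is positive: if `f` vanishes
at `p` but not everywhere near `p`, the zero set of `f` in the given neighbourhood of `p` meets
some closed ball `B(y, R)` in a single point `q`, which lies on its boundary. The ball is obtained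
by halving, towards the touching point, a ball around a point where `f` does not vanish. -/
theorem exists_touching_ball [FiniteDimensional ℝ E] {f : E → ℝ} {p : E} {r : ℝ}
    (hf : ContinuousOn f (Metric.ball p r)) (hnn : ∀ z ∈ Metric.ball p r, 0 ≤ f z)
    (hr : 0 < r) (hp : f p = 0) (hne : ¬ ∀ᶠ z in 𝓝 p, f z = 0) :
    ∃ y q R, 0 < R ∧ q ∈ Metric.ball p r ∧ f q = 0 ∧ dist q y = R ∧
      ∀ z ∈ Metric.ball p r, dist z y ≤ R → z ≠ q → 0 < f z := by
  obtain ⟨a, ha, hfa⟩ : ∃ a ∈ Metric.ball p (r / 4), f a ≠ 0 := by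
    by_contra! hcon
    exact hne (eventually_of_mem (Metric.ball_mem_nhds p (by positivity)) hcon)
  have hsub : Metric.closedBall p (r / 2) ⊆ Metric.ball p r :=
    Metric.closedBall_subset_ball (by linarith)
  set Z := Metric.closedBall p (r / 2) ∩ f ⁻¹' {0}
  have hZ : IsCompact Z := (isCompact_closedBall p (r / 2)).of_isClosed_subset
    ((hf.mono hsub).preimage_isClosed_of_isClosed Metric.isClosed_closedBall isClosed_singleton)
    inter_subset_left
  have hpZ : p ∈ Z := ⟨Metric.mem_closedBall_self (by positivity), hp⟩
  obtain ⟨q, hqZ, hqmin⟩ := hZ.exists_isMinOn ⟨p, hpZ⟩ (f := fun z => dist z a) (by fun_prop)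
  have hqa : dist q a < r / 4 := by
    have h1 : dist q a ≤ dist p a := hqmin hpZ
    rw [dist_comm p a] at h1
    exact h1.trans_lt ha
  have hane : q ≠ a := by
    rintro rfl
    exact hfa hqZ.2
  have hpos : 0 < dist q a := dist_pos.2 hane
  refine ⟨midpoint ℝ q a, q, dist q a / 2, by positivity, hsub hqZ.1, hqZ.2, ?_, ?_⟩
  · rw [dist_left_midpoint]
    simp
    ring
  · intro z hz hzy hzq
    refine lt_of_le_of_ne (hnn z hz) fun h0 => ?_
    have hma : dist (midpoint ℝ q a) a = dist q a / 2 := by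
      rw [dist_midpoint_right]; simp; ring
    have hza : dist z a ≤ dist q a := by
      have := dist_triangle z (midpoint ℝ q a) a
      linarith
    have hzZ : z ∈ Z := by
      refine ⟨?_, h0.symm⟩
      have := dist_triangle z a p
      rw [Metric.mem_ball] at ha
      rw [Metric.mem_closedBall]
      linarith
    have hqz : dist q a ≤ dist z a := hqmin hzZ
    -- equality in the triangle inequality for `z`, the midpoint and `a` forces `z = q`
    apply hzq
    have hm1 : dist z (midpoint ℝ q a) = dist z a / 2 := by
      have := dist_triangle z (midpoint ℝ q a) a
      linarith
    have hm2 : dist (midpoint ℝ q a) a = dist z a / 2 := by linarith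
    have hmid : midpoint ℝ q a = midpoint ℝ z a :=
      eq_midpoint_of_dist_eq_half hm1 hm2
    have := congrArg (fun w => (2 : ℝ) • w) hmid
    simpa [midpoint_eq_smul_add, smul_smul] using this.symm

/-- E. Hopf's strong minimum principle for nonnegative solutions of `Δ f ≤ C |∇ f|`. -/
theorem eventually_eq_zero_of_laplacian_le [FiniteDimensional ℝ E] {Ω : Set E} {f : E → ℝ}
    (hΩ : IsOpen Ω) (hf : ContDiffOn ℝ ∞ f Ω) (hnn : ∀ z ∈ Ω, 0 ≤ f z) {C : ℝ}
    (hle : ∀ z ∈ Ω, (Δ f) z ≤ C * ‖fderiv ℝ f z‖) {p : E} (hpΩ : p ∈ Ω) (hp : f p = 0) :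
    ∀ᶠ z in 𝓝 p, f z = 0 := by
  by_contra hne
  obtain ⟨r, hr, hrΩ⟩ := Metric.isOpen_iff.1 hΩ p hpΩ
  obtain ⟨y, q, R, hR, hq, hfq, hqy, hpos⟩ := exists_touching_ball (hf.continuousOn.mono hrΩ)
    (fun z hz => hnn z (hrΩ hz)) hr hp hne
  obtain ⟨ρ₀, hρ₀, hρ₀Ω⟩ := Metric.isOpen_iff.1 Metric.isOpen_ball q hq
  set ρ := min (ρ₀ / 2) (R / 2)
  have hρ : 0 < ρ := lt_min (by positivity) (by positivity)
  have hρb : Metric.closedBall q ρ ⊆ Metric.ball p r := fun z hz => hρ₀Ω (by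
    rw [Metric.mem_closedBall] at hz
    rw [Metric.mem_ball]
    have : ρ ≤ ρ₀ / 2 := min_le_left _ _
    linarith)
  have hdist : ∀ z ∈ Metric.closedBall q ρ, R / 2 ≤ ‖z - y‖ ∧ ‖z - y‖ ≤ 2 * R := by
    intro z hz
    rw [Metric.mem_closedBall] at hz
    have h0 : ρ ≤ R / 2 := min_le_right _ _
    have h1 := dist_triangle z q y
    have h2 := dist_triangle q z y
    rw [dist_comm q z] at h2
    rw [← dist_eq_norm]
    constructor <;> linarith
  set b := stdOrthonormalBasis ℝ E
  set N : ℝ := ((Fintype.card (Fin (Module.finrank ℝ E)) : ℕ) : ℝ)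
  have hN : 0 ≤ N := Nat.cast_nonneg _
  set α := (N + |C| * (2 * R) + 1) * 2 / R ^ 2
  have hα : 0 < α := by positivity
  have hαR : 2 * α * (R / 2) ^ 2 = N + |C| * (2 * R) + 1 := by
    simp only [α]; field_simp
  set c := Real.exp (-α * R ^ 2)
  have hc : 0 < c := Real.exp_pos _
  -- `f` is bounded below on the part of the small sphere where the barrier is nonnegative
  set K := Metric.sphere q ρ ∩ Metric.closedBall y R
  have hK : IsCompact K := (isCompact_sphere q ρ).inter_right Metric.isClosed_closedBall
  have hsph : Metric.sphere q ρ ⊆ Metric.closedBall q ρ := Metric.sphere_subset_closedBall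
  obtain ⟨δ, hδ, hδK⟩ : ∃ δ > 0, ∀ z ∈ K, δ ≤ f z := by
    rcases K.eq_empty_or_nonempty with h0 | h0
    · exact ⟨1, one_pos, by simp [h0]⟩
    · obtain ⟨w, hw, hwmin⟩ := hK.exists_isMinOn h0 (f := f)
        (hf.continuousOn.mono fun z hz => hrΩ (hρb (hsph hz.1)))
      refine ⟨f w, hpos w (hρb (hsph hw.1)) hw.2 ?_, fun z hz => hwmin hz⟩
      rintro rfl
      have : dist w w = ρ := hw.1
      simp at this
      linarith
  set ε := δ / 2
  have hε : 0 < ε := by positivity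
  set g : E → ℝ := fun z => f z - ε * (Real.exp (-α * ‖z - y‖ ^ 2) - c) with hg
  have hgc : ContinuousOn g (Metric.closedBall q ρ) := by
    refine (hf.continuousOn.mono fun z hz => hrΩ (hρb hz)).sub (Continuous.continuousOn ?_)
    exact continuous_const.mul ((contDiff_exp_neg_norm_sq α y).continuous.sub continuous_const)
  have hgq : g q = 0 := by
    simp only [hg, hfq, ← dist_eq_norm, hqy, c]
    ring
  have hgs : ∀ z ∈ Metric.sphere q ρ, 0 < g z := by
    intro z hz
    by_cases hzR : dist z y ≤ R
    · have h1 := hδK z ⟨hz, hzR⟩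
      have h2 : Real.exp (-α * ‖z - y‖ ^ 2) ≤ 1 := by
        rw [Real.exp_le_one_iff]
        have : 0 ≤ α * ‖z - y‖ ^ 2 := by positivity
        linarith
      have h3 : ε * (Real.exp (-α * ‖z - y‖ ^ 2) - c) ≤ ε * 1 :=
        mul_le_mul_of_nonneg_left (by linarith) hε.le
      simp only [hg]
      have : ε = δ / 2 := rfl
      linarith
    · have h1 : Real.exp (-α * ‖z - y‖ ^ 2) < c := by
        rw [Real.exp_lt_exp, ← dist_eq_norm]
        have : R ^ 2 < dist z y ^ 2 := pow_lt_pow_left₀ (not_le.1 hzR) hR.le two_ne_zero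
        nlinarith
      have h2 := hnn z (hrΩ (hρb (hsph hz)))
      have h3 : ε * (Real.exp (-α * ‖z - y‖ ^ 2) - c) < 0 :=
        mul_neg_of_pos_of_neg hε (by linarith)
      simp only [hg]
      linarith
  obtain ⟨x, hx, hxmin⟩ := (isCompact_closedBall q ρ).exists_isMinOn
    ⟨q, Metric.mem_closedBall_self hρ.le⟩ hgc
  have hxq : g x ≤ 0 := hgq ▸ hxmin (Metric.mem_closedBall_self hρ.le)
  have hxball : x ∈ Metric.ball q ρ := by
    rw [← Metric.closedBall_sdiff_sphere]
    exact ⟨hx, fun hs => absurd (hgs x hs) (not_lt.2 hxq)⟩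
  have hloc : IsLocalMin g x := hxmin.isLocalMin
    (mem_of_superset (Metric.isOpen_ball.mem_nhds hxball) Metric.ball_subset_closedBall)
  refine not_isLocalMin_sub_barrier b hΩ hf hα hε (hrΩ (hρb hx)) (hle x (hrΩ (hρb hx))) ?_ hloc
  obtain ⟨h1, h2⟩ := hdist x hx
  have h3 : C * ‖x - y‖ ≤ |C| * (2 * R) :=
    mul_le_mul (le_abs_self C) h2 (norm_nonneg _) (abs_nonneg C)
  have h4 : 2 * α * (R / 2) ^ 2 ≤ 2 * α * ‖x - y‖ ^ 2 := by gcongr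
  have h5 : (Fintype.card (Fin (Module.finrank ℝ E)) : ℝ) = N := rfl
  linarith

end

/-! ### The differential inequality for `σ₂` of the Hessian -/

section

variable {E : Type*} [NormedAddCommGroup E] [NormedSpace ℝ E] {Ω : Set E} {u : E → ℝ} {x : E}

/-- Fourth derivatives commute: `∂ᵥ∂ᵥ∂_w∂_w u = ∂_w∂_w∂ᵥ∂ᵥ u`. -/
theorem dirDeriv_dirDeriv_swap (hΩ : IsOpen Ω) (hu : ContDiffOn ℝ ∞ u Ω) (v w : E) :
    EqOn (dirDeriv v (dirDeriv v (dirDeriv w (dirDeriv w u))))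
      (dirDeriv w (dirDeriv w (dirDeriv v (dirDeriv v u)))) Ω := by
  have h : ∀ {f : E → ℝ}, ContDiffOn ℝ ∞ f Ω → EqOn (dirDeriv v (dirDeriv w (dirDeriv w f)))
      (dirDeriv w (dirDeriv w (dirDeriv v f))) Ω := fun hf =>
    (dirDeriv_comm hΩ (hf.dirDeriv hΩ w) v w).trans ((dirDeriv_comm hΩ hf v w).dirDeriv hΩ w)
  exact ((h hu).dirDeriv hΩ v).trans (h (hu.dirDeriv hΩ v))

variable {κ : Type*} [Fintype κ] {F h : E → ℝ} {w : κ → E → ℝ}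

theorem dirDeriv_half_sq_sub_sum_sq (hΩ : IsOpen Ω) (hh : ContDiffOn ℝ ∞ h Ω)
    (hw : ∀ k, ContDiffOn ℝ ∞ (w k) Ω)
    (hF : EqOn F (fun y => 1 / 2 * (h y ^ 2 - ∑ k, w k y ^ 2)) Ω) (v : E) :
    EqOn (dirDeriv v F) (fun y => h y * dirDeriv v h y - ∑ k, w k y * dirDeriv v (w k) y) Ω := by
  intro y hy
  have h1 := hh.differentiableAt_of_isOpen hΩ hy
  have h2 := fun k => (hw k).differentiableAt_of_isOpen hΩ hy
  have h3 : DifferentiableAt ℝ (fun y => ∑ k, w k y ^ 2) y :=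
    DifferentiableAt.fun_sum fun k _ => (h2 k).pow 2
  rw [hF.dirDeriv hΩ v hy,
    dirDeriv_const_mul (f := fun y => h y ^ 2 - ∑ k, w k y ^ 2) v _ ((h1.pow 2).sub h3),
    dirDeriv_sub (f := fun y => h y ^ 2) v (h1.pow 2) h3, dirDeriv_sq v h1,
    dirDeriv_sum (f := fun k y => w k y ^ 2) Finset.univ v fun k _ => (h2 k).pow 2]
  simp_rw [dirDeriv_sq v (h2 _), ← Finset.mul_sum]
  ring

theorem dirDeriv_dirDeriv_half_sq_sub_sum_sq (hΩ : IsOpen Ω) (hh : ContDiffOn ℝ ∞ h Ω)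
    (hw : ∀ k, ContDiffOn ℝ ∞ (w k) Ω)
    (hF : EqOn F (fun y => 1 / 2 * (h y ^ 2 - ∑ k, w k y ^ 2)) Ω) (hx : x ∈ Ω) (v : E) :
    dirDeriv v (dirDeriv v F) x = dirDeriv v h x ^ 2 + h x * dirDeriv v (dirDeriv v h) x
      - ∑ k, (dirDeriv v (w k) x ^ 2 + w k x * dirDeriv v (dirDeriv v (w k)) x) := by
  have h1 := hh.differentiableAt_of_isOpen hΩ hx
  have h2 := fun k => (hw k).differentiableAt_of_isOpen hΩ hx
  have h1' := (hh.dirDeriv hΩ v).differentiableAt_of_isOpen hΩ hx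
  have h2' := fun k => ((hw k).dirDeriv hΩ v).differentiableAt_of_isOpen hΩ hx
  have h3 : DifferentiableAt ℝ (fun y => ∑ k, w k y * dirDeriv v (w k) y) x :=
    DifferentiableAt.fun_sum fun k _ => (h2 k).mul (h2' k)
  rw [(dirDeriv_half_sq_sub_sum_sq hΩ hh hw hF v).dirDeriv hΩ v hx,
    dirDeriv_sub (f := fun y => h y * dirDeriv v h y) v (h1.mul h1') h3, dirDeriv_mul v h1 h1',
    dirDeriv_sum (f := fun k y => w k y * dirDeriv v (w k) y) Finset.univ v
      fun k _ => (h2 k).mul (h2' k)]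
  simp_rw [dirDeriv_mul v (h2 _) (h2' _), ← pow_two]

end

section

variable {E ι : Type*} [NormedAddCommGroup E] [InnerProductSpace ℝ E] [FiniteDimensional ℝ E]
  [Fintype ι] [DecidableEq ι] {Ω : Set E} {u F h : E → ℝ} {x : E}

/-- A Bochner-type identity: the Laplacian of `F = ((Δu)² - |D²u|²) / 2`, at a point where the
orthonormal basis `b` diagonalizes `D²u` with eigenvalues `l i`. -/
theorem laplacian_half_sq_sub_hessian_sq (b : OrthonormalBasis ι ℝ E) (hΩ : IsOpen Ω)
    (hu : ContDiffOn ℝ ∞ u Ω) (hh : ContDiffOn ℝ ∞ h Ω) (hlap : ∀ y ∈ Ω, (Δ u) y = h y)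
    (hF : EqOn F (fun y => 1 / 2 * (h y ^ 2 -
      ∑ p : ι × ι, dirDeriv (b p.1) (dirDeriv (b p.2) u) y ^ 2)) Ω)
    (hFs : ContDiffOn ℝ ∞ F Ω) (hx : x ∈ Ω) (l : ι → ℝ)
    (hl : ∀ i j, dirDeriv (b i) (dirDeriv (b j) u) x = if i = j then l i else 0) :
    (Δ F) x = ∑ k, dirDeriv (b k) h x ^ 2
      + ∑ k, (h x - l k) * dirDeriv (b k) (dirDeriv (b k) h) x
      - ∑ k, ∑ i, ∑ j, dirDeriv (b k) (dirDeriv (b i) (dirDeriv (b j) u)) x ^ 2 := by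
  have hU : ∀ p : ι × ι, ContDiffOn ℝ ∞ (dirDeriv (b p.1) (dirDeriv (b p.2) u)) Ω :=
    fun p => (hu.dirDeriv hΩ _).dirDeriv hΩ _
  rw [laplacian_eq_sum_dirDeriv b hΩ hFs hx]
  simp_rw [dirDeriv_dirDeriv_half_sq_sub_sum_sq hΩ hh hU hF hx, Fintype.sum_prod_type, hl,
    Finset.sum_sub_distrib, Finset.sum_add_distrib]
  -- differentiating `Δu = h` twice
  have hlap2 : ∀ i, ∑ k, dirDeriv (b k) (dirDeriv (b k) (dirDeriv (b i) (dirDeriv (b i) u))) x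
      = dirDeriv (b i) (dirDeriv (b i) h) x := by
    intro i
    have hs : ∀ k, ContDiffOn ℝ ∞ (dirDeriv (b k) (dirDeriv (b k) u)) Ω := fun k => hU (k, k)
    have e0 : EqOn h (fun y => ∑ k, dirDeriv (b k) (dirDeriv (b k) u) y) Ω := fun y hy => by
      rw [← hlap y hy, laplacian_eq_sum_dirDeriv b hΩ hu hy]
    have e1 : EqOn (dirDeriv (b i) h)
        (fun y => ∑ k, dirDeriv (b i) (dirDeriv (b k) (dirDeriv (b k) u)) y) Ω :=
      (e0.dirDeriv hΩ (b i)).trans fun y hy =>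
        dirDeriv_sum _ _ fun k _ => (hs k).differentiableAt_of_isOpen hΩ hy
    rw [e1.dirDeriv hΩ (b i) hx, dirDeriv_sum _ _ fun k _ =>
      ((hs k).dirDeriv hΩ (b i)).differentiableAt_of_isOpen hΩ hx]
    exact Finset.sum_congr rfl fun k _ => dirDeriv_dirDeriv_swap hΩ hu (b k) (b i) hx
  have e2 : ∑ k, ∑ i, ∑ j, (if i = j then l i else 0)
      * dirDeriv (b k) (dirDeriv (b k) (dirDeriv (b i) (dirDeriv (b j) u))) x
      = ∑ i, l i * dirDeriv (b i) (dirDeriv (b i) h) x := by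
    rw [Finset.sum_comm]
    simp_rw [← hlap2, Finset.mul_sum]
    simp
  rw [e2]
  simp_rw [sub_mul, Finset.sum_sub_distrib, ← Finset.mul_sum]
  ring

/-- The key differential inequality. The third derivatives enter the Laplacian of `F` with the
favourable sign, and they are large because the derivative of `F` prescribes `∑ λᵢ u_{iim}` up to
an error of size `|∇F|`. -/
theorem laplacian_half_sq_sub_hessian_sq_le (b : OrthonormalBasis ι ℝ E) (hΩ : IsOpen Ω)
    (hu : ContDiffOn ℝ ∞ u Ω) {J : Set ℝ} (hJ : IsOpen J) {G : ℝ → ℝ} (hG : ContDiffOn ℝ ∞ G J)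
    (huJ : MapsTo u Ω J) {A : ℝ} (hA : A ≤ 2) (hlap : ∀ y ∈ Ω, (Δ u) y = G (u y))
    (hF : EqOn F (fun y => 1 / 2 * (G (u y) ^ 2 -
      ∑ p : ι × ι, dirDeriv (b p.1) (dirDeriv (b p.2) u) y ^ 2)) Ω)
    (hFs : ContDiffOn ℝ ∞ F Ω) (hx : x ∈ Ω) (hpos : 0 < G (u x))
    (hstruct : G (u x) * deriv (deriv G) (u x) ≤ A * deriv G (u x) ^ 2)
    (l : ι → ℝ) (hl0 : ∀ i, 0 ≤ l i)
    (hl : ∀ i j, dirDeriv (b i) (dirDeriv (b j) u) x = if i = j then l i else 0) :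
    (Δ F) x ≤ 2 * deriv G (u x) * F x
      + 8 * Fintype.card ι * ‖fderiv ℝ (fun y => G (u y)) x‖ / G (u x) * ‖fderiv ℝ F x‖ := by
  set h : E → ℝ := fun y => G (u y)
  have hh : ContDiffOn ℝ ∞ h Ω := hG.comp hu huJ
  have hU : ∀ p : ι × ι, ContDiffOn ℝ ∞ (dirDeriv (b p.1) (dirDeriv (b p.2) u)) Ω :=
    fun p => (hu.dirDeriv hΩ _).dirDeriv hΩ _
  rw [laplacian_half_sq_sub_hessian_sq b hΩ hu hh hlap hF hFs hx l hl]
  set S := G (u x)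
  have hhx : h x = S := rfl
  have hlS : ∑ i, l i = S := by
    have := laplacian_eq_sum_dirDeriv b hΩ hu hx
    rw [hlap x hx] at this
    simp only [hl, if_true] at this
    exact this.symm
  -- derivatives of `h = G ∘ u`
  have hd1 : ∀ k, EqOn (dirDeriv (b k) h) (fun y => deriv G (u y) * dirDeriv (b k) u y) Ω :=
    fun k y hy => dirDeriv_comp _ ((hG.contDiffAt (hJ.mem_nhds (huJ hy))).differentiableAt (by simp))
      (hu.differentiableAt_of_isOpen hΩ hy)
  have hG' : DifferentiableAt ℝ (deriv G) (u x) :=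
    ((hG.deriv_of_isOpen hJ (m := ∞) (by simp)).contDiffAt
      (hJ.mem_nhds (huJ hx))).differentiableAt (by simp)
  have hux := hu.differentiableAt_of_isOpen hΩ hx
  have hd2 : ∀ k, dirDeriv (b k) (dirDeriv (b k) h) x
      = deriv (deriv G) (u x) * dirDeriv (b k) u x ^ 2 + deriv G (u x) * l k := by
    intro k
    rw [(hd1 k).dirDeriv hΩ _ hx, dirDeriv_mul (f := fun y => deriv G (u y)) _
      (hG'.comp x hux) ((hu.dirDeriv hΩ _).differentiableAt_of_isOpen hΩ hx),
      dirDeriv_comp _ hG' hux, hl, if_pos rfl]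
    ring
  -- the gradient of `F`
  have hdF : ∀ m, dirDeriv (b m) F x = S * dirDeriv (b m) h x
      - ∑ i, l i * dirDeriv (b i) (dirDeriv (b i) (dirDeriv (b m) u)) x := by
    intro m
    rw [dirDeriv_half_sq_sub_sum_sq hΩ hh hU hF (b m) hx]
    simp only [hhx, Fintype.sum_prod_type, hl, ite_mul, zero_mul, Finset.sum_ite_eq, Finset.mem_univ,
      if_true]
    congr 1
    refine Finset.sum_congr rfl fun i _ => ?_
    rw [dirDeriv_comm hΩ (hu.dirDeriv hΩ (b i)) (b m) (b i) hx,
      (dirDeriv_comm hΩ hu (b m) (b i)).dirDeriv hΩ (b i) hx]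
  have hFx : F x = 1 / 2 * (S ^ 2 - ∑ i, l i ^ 2) := by
    rw [hF hx]
    simp [Fintype.sum_prod_type, hl, S]
  have hT := sum_diag_sq_le_sum_sq
    (fun i j k => dirDeriv (b i) (dirDeriv (b j) (dirDeriv (b k) u)) x)
    (fun i j k => dirDeriv_comm hΩ (hu.dirDeriv hΩ (b k)) (b i) (b j) hx)
    (fun i j k => (dirDeriv_comm hΩ hu (b j) (b k)).dirDeriv hΩ (b i) hx)
  have hcost := Finset.sum_le_sum fun m (_ : m ∈ Finset.univ) =>
    weighted_sum_sq_lower_bound l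
      (fun i => dirDeriv (b i) (dirDeriv (b i) (dirDeriv (b m) u)) x) hl0 m S
      (dirDeriv (b m) h x) (dirDeriv (b m) F x) hpos hlS (hdF m)
  have hgrad : ∀ (f : E → ℝ) m, |dirDeriv (b m) f x| ≤ ‖fderiv ℝ f x‖ := by
    intro f m
    have := (fderiv ℝ f x).le_opNorm (b m)
    rwa [b.norm_eq_one, mul_one] at this
  have herr : ∑ m, 8 * |dirDeriv (b m) h x| * |dirDeriv (b m) F x| / S
      ≤ 8 * Fintype.card ι * ‖fderiv ℝ h x‖ / S * ‖fderiv ℝ F x‖ := by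
    calc ∑ m, 8 * |dirDeriv (b m) h x| * |dirDeriv (b m) F x| / S
        ≤ ∑ _m : ι, 8 * ‖fderiv ℝ h x‖ * ‖fderiv ℝ F x‖ / S := by
          gcongr with m _
          · exact hgrad h m
          · exact hgrad F m
      _ = _ := by
          rw [Finset.sum_const, Finset.card_univ, nsmul_eq_mul]
          ring
  have hmain : ∀ k, dirDeriv (b k) h x ^ 2
      + (S - l k) * (deriv (deriv G) (u x) * dirDeriv (b k) u x ^ 2)
      ≤ dirDeriv (b k) h x ^ 2 * (3 - 2 * l k / S) := by
    intro k
    have hk : l k ≤ S := hlS ▸ Finset.single_le_sum (fun i _ => hl0 i) (Finset.mem_univ k)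
    rw [hd1 k hx]
    set g := deriv G (u x)
    set g2 := deriv (deriv G) (u x)
    set d := dirDeriv (b k) u x
    have h1 : S * g2 ≤ 2 * g ^ 2 := hstruct.trans (mul_le_mul_of_nonneg_right hA (sq_nonneg g))
    have h2 : g2 ≤ 2 * g ^ 2 / S := by rw [le_div_iff₀ hpos]; linarith
    have h3 : (S - l k) * (g2 * d ^ 2) ≤ (S - l k) * (2 * g ^ 2 / S * d ^ 2) :=
      mul_le_mul_of_nonneg_left (mul_le_mul_of_nonneg_right h2 (sq_nonneg d)) (by linarith)
    have h4 : (g * d) ^ 2 * (3 - 2 * l k / S)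
        = (g * d) ^ 2 + (S - l k) * (2 * g ^ 2 / S * d ^ 2) := by
      field_simp
      ring
    rw [h4]
    linarith
  have hmain' := Finset.sum_le_sum fun k (_ : k ∈ Finset.univ) => hmain k
  have hsplit : ∑ k, (S - l k) * dirDeriv (b k) (dirDeriv (b k) h) x
      = ∑ k, (S - l k) * (deriv (deriv G) (u x) * dirDeriv (b k) u x ^ 2)
        + 2 * deriv G (u x) * F x := by
    simp_rw [hd2, mul_add, Finset.sum_add_distrib]
    congr 1
    have : ∀ k, (S - l k) * (deriv G (u x) * l k) = deriv G (u x) * (S * l k - l k ^ 2) := by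
      intro k; ring
    simp_rw [this, ← Finset.mul_sum, Finset.sum_sub_distrib, ← Finset.mul_sum, hlS, hFx]
    ring
  rw [hhx, hsplit]
  rw [Finset.sum_sub_distrib] at hcost
  rw [Finset.sum_add_distrib] at hmain'
  linarith

end

/-! ### `σ₂` of the Hessian of a convex function -/

section

variable {n : ℕ} {Ω : Set (EuclideanSpace ℝ (Fin n))} {u : EuclideanSpace ℝ (Fin n) → ℝ}
  {x : EuclideanSpace ℝ (Fin n)}

theorem hessianMatrix_apply (u : EuclideanSpace ℝ (Fin n) → ℝ) (x : EuclideanSpace ℝ (Fin n))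
    (i j : Fin n) : hessianMatrix u x i j =
      fderiv ℝ (fderiv ℝ u) x (EuclideanSpace.single i 1) (EuclideanSpace.single j 1) := by
  simp [hessianMatrix, iteratedFDeriv_two_apply]

theorem isHermitian_hessianMatrix (hΩ : IsOpen Ω) (hu : ContDiffOn ℝ ∞ u Ω) (hx : x ∈ Ω) :
    (hessianMatrix u x).IsHermitian := by
  refine Matrix.IsHermitian.ext fun i j => ?_
  rw [star_trivial, hessianMatrix_apply, hessianMatrix_apply, ← dirDeriv_dirDeriv_eq hΩ hu hx,
    ← dirDeriv_dirDeriv_eq hΩ hu hx]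
  exact dirDeriv_comm hΩ hu _ _ hx

theorem dirDeriv_eigenvectorBasis (hΩ : IsOpen Ω) (hu : ContDiffOn ℝ ∞ u Ω) (hx : x ∈ Ω)
    (hM : (hessianMatrix u x).IsHermitian) (i j : Fin n) :
    dirDeriv (hM.eigenvectorBasis i) (dirDeriv (hM.eigenvectorBasis j) u) x
      = if i = j then hM.eigenvalues i else 0 := by
  rw [dirDeriv_dirDeriv_eq hΩ hu hx]
  exact hM.bilin_eigenvectorBasis _ (hessianMatrix_apply u x) i j

theorem sum_eigenvalues_hessianMatrix (hΩ : IsOpen Ω) (hu : ContDiffOn ℝ ∞ u Ω) (hx : x ∈ Ω)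
    (hM : (hessianMatrix u x).IsHermitian) : ∑ i, hM.eigenvalues i = (Δ u) x := by
  rw [laplacian_eq_sum_dirDeriv hM.eigenvectorBasis hΩ hu hx]
  simp [dirDeriv_eigenvectorBasis hΩ hu hx hM]

theorem sigmaK_two_hessianMatrix (hΩ : IsOpen Ω) (hu : ContDiffOn ℝ ∞ u Ω) {ι : Type*} [Fintype ι]
    (b : OrthonormalBasis ι ℝ (EuclideanSpace ℝ (Fin n))) (hx : x ∈ Ω) :
    sigmaK 2 (hessianMatrix u x) = 1 / 2 * ((Δ u) x ^ 2 -
      ∑ p : ι × ι, dirDeriv (b p.1) (dirDeriv (b p.2) u) x ^ 2) := by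
  have hM := isHermitian_hessianMatrix hΩ hu hx
  have h1 := hM.two_mul_sigmaK_two
  rw [sum_eigenvalues_hessianMatrix hΩ hu hx hM] at h1
  have h2 := b.sum_sq_bilin_eq hM.eigenvectorBasis (fderiv ℝ (fderiv ℝ u) x) fun v w => by
    rw [← dirDeriv_dirDeriv_eq hΩ hu hx, ← dirDeriv_dirDeriv_eq hΩ hu hx]
    exact dirDeriv_comm hΩ hu v w hx
  simp_rw [← dirDeriv_dirDeriv_eq hΩ hu hx, dirDeriv_eigenvectorBasis hΩ hu hx hM] at h2
  simp only [ite_pow, ne_eq, OfNat.ofNat_ne_zero, not_false_eq_true, zero_pow, Finset.sum_ite_eq,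
    Finset.mem_univ, if_true] at h2
  rw [Fintype.sum_prod_type, h2]
  linarith

theorem contDiffOn_sigmaK_two (hΩ : IsOpen Ω) (hu : ContDiffOn ℝ ∞ u Ω) {h : _ → ℝ}
    (hh : ContDiffOn ℝ ∞ h Ω) (hlap : ∀ y ∈ Ω, (Δ u) y = h y) :
    ContDiffOn ℝ ∞ (fun x => sigmaK 2 (hessianMatrix u x)) Ω := by
  have hs : ContDiffOn ℝ ∞ (fun y => 1 / 2 * (h y ^ 2 - ∑ p : Fin n × Fin n,
      dirDeriv (EuclideanSpace.basisFun (Fin n) ℝ p.1)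
        (dirDeriv (EuclideanSpace.basisFun (Fin n) ℝ p.2) u) y ^ 2)) Ω :=
    contDiffOn_const.mul ((hh.pow 2).sub (ContDiffOn.sum fun p _ =>
      ((hu.dirDeriv hΩ _).dirDeriv hΩ _).pow 2))
  refine hs.congr fun y hy => ?_
  rw [sigmaK_two_hessianMatrix hΩ hu (EuclideanSpace.basisFun (Fin n) ℝ) hy, hlap y hy]

theorem eigenvalues_hessianMatrix_nonneg (hΩ : IsOpen Ω) (hu : ContDiffOn ℝ ∞ u Ω)
    (hconv : IsConvexFunctionOn Ω u) (hx : x ∈ Ω) (hM : (hessianMatrix u x).IsHermitian)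
    (i : Fin n) : 0 ≤ hM.eigenvalues i := by
  obtain ⟨r, hr, hrΩ⟩ := Metric.isOpen_iff.1 hΩ x hx
  have h := (hconv _ hrΩ (convex_ball x r)).dirDeriv_dirDeriv_nonneg Metric.isOpen_ball
    (hu.mono hrΩ) (Metric.mem_ball_self hr) (hM.eigenvectorBasis i)
  rwa [dirDeriv_eigenvectorBasis hΩ hu hx hM, if_pos rfl] at h

theorem sigmaK_two_hessianMatrix_nonneg (hΩ : IsOpen Ω) (hu : ContDiffOn ℝ ∞ u Ω)
    (hconv : IsConvexFunctionOn Ω u) (hx : x ∈ Ω) : 0 ≤ sigmaK 2 (hessianMatrix u x) := by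
  have hM := isHermitian_hessianMatrix hΩ hu hx
  have h1 := hM.two_mul_sigmaK_two
  have h2 := Finset.sum_sq_le_sq_sum_of_nonneg (s := Finset.univ) fun i _ =>
    eigenvalues_hessianMatrix_nonneg hΩ hu hconv hx hM i
  linarith

/-- A positive semidefinite Hessian with positive trace and `σ₂ = 0` has exactly one nonzero
eigenvalue. -/
theorem rank_hessianMatrix_eq_one (hΩ : IsOpen Ω) (hu : ContDiffOn ℝ ∞ u Ω)
    (hconv : IsConvexFunctionOn Ω u) (hx : x ∈ Ω) (hpos : 0 < (Δ u) x)
    (hσ : sigmaK 2 (hessianMatrix u x) = 0) : (hessianMatrix u x).rank = 1 := by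
  have hM := isHermitian_hessianMatrix hΩ hu hx
  have hl := eigenvalues_hessianMatrix_nonneg hΩ hu hconv hx hM
  have hsum := sum_eigenvalues_hessianMatrix hΩ hu hx hM
  have h1 := hM.two_mul_sigmaK_two
  rw [hσ, mul_zero, hsum] at h1
  rw [hM.rank_eq_card_non_zero_eigs]
  set l := hM.eigenvalues
  set S := (Δ u) x
  have hle : ∀ k, l k ≤ S := fun k =>
    hsum ▸ Finset.single_le_sum (fun i _ => hl i) (Finset.mem_univ k)
  have hz : ∑ k, l k * (S - l k) = 0 := by
    simp_rw [mul_sub, Finset.sum_sub_distrib, ← Finset.sum_mul, hsum, ← pow_two]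
    linarith
  have hz' : ∀ k, l k * (S - l k) = 0 := fun k =>
    (Finset.sum_eq_zero_iff_of_nonneg fun i _ =>
      mul_nonneg (hl i) (sub_nonneg.2 (hle i))).1 hz k (Finset.mem_univ k)
  obtain ⟨i, hi⟩ : ∃ i, l i ≠ 0 := by
    by_contra! h0
    simp [h0] at hsum
    linarith
  have hiS : l i = S := by
    have := (mul_eq_zero.1 (hz' i)).resolve_left hi
    linarith
  rw [Fintype.card_eq_one_iff]
  refine ⟨⟨i, hi⟩, fun ⟨j, hj⟩ => Subtype.ext ?_⟩
  by_contra hji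
  have h2 : l i + l j ≤ ∑ k, l k := by
    rw [← Finset.sum_pair (f := l) (Ne.symm hji)]
    exact Finset.sum_le_sum_of_subset_of_nonneg (Finset.subset_univ _) fun k _ _ => hl k
  have h3 : 0 < l j := lt_of_le_of_ne (hl j) (Ne.symm hj)
  linarith

theorem laplacian_sigmaK_two_le (hΩ : IsOpen Ω) (hu : ContDiffOn ℝ ∞ u Ω)
    (hconv : IsConvexFunctionOn Ω u) {J : Set ℝ} (hJ : IsOpen J) {G : ℝ → ℝ}
    (hG : ContDiffOn ℝ ∞ G J) (huJ : MapsTo u Ω J) {A : ℝ} (hA : A ≤ 2)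
    (hlap : ∀ y ∈ Ω, (Δ u) y = G (u y)) (hx : x ∈ Ω) (hpos : 0 < G (u x))
    (hstruct : G (u x) * deriv (deriv G) (u x) ≤ A * deriv G (u x) ^ 2) :
    (Δ (fun y => sigmaK 2 (hessianMatrix u y))) x
      ≤ 2 * deriv G (u x) * sigmaK 2 (hessianMatrix u x)
        + 8 * n * ‖fderiv ℝ (fun y => G (u y)) x‖ / G (u x)
          * ‖fderiv ℝ (fun y => sigmaK 2 (hessianMatrix u y)) x‖ := by
  have hM := isHermitian_hessianMatrix hΩ hu hx
  have := laplacian_half_sq_sub_hessian_sq_le hM.eigenvectorBasis hΩ hu hJ hG huJ hA hlap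
    (F := fun y => sigmaK 2 (hessianMatrix u y))
    (fun y hy => by
      simp only
      rw [sigmaK_two_hessianMatrix hΩ hu hM.eigenvectorBasis hy, hlap y hy])
    (contDiffOn_sigmaK_two hΩ hu (hG.comp hu huJ) hlap) hx hpos hstruct hM.eigenvalues
    (eigenvalues_hessianMatrix_nonneg hΩ hu hconv hx hM)
    (dirDeriv_eigenvectorBasis hΩ hu hx hM)
  rwa [Fintype.card_fin] at this

end

theorem theorem2 (n : ℕ) (Ω : Set (EuclideanSpace ℝ (Fin n)))
    (hΩ_open : IsOpen Ω) (hΩ_conn : IsConnected Ω)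
    (J : Set ℝ) (hJ : IsOpen J) (G : ℝ → ℝ) (hG : ContDiffOn ℝ ∞ G J)
    (A : ℝ) (hA : A ≤ 2)
    (hG_pos : ∀ t ∈ J, 0 < G t)
    (hG_deriv : ∀ t ∈ J, deriv G t < 0)
    (hG_struct : ∀ t ∈ J, G t * deriv (deriv G) t ≤ A * (deriv G t) ^ 2)
    (u : EuclideanSpace ℝ (Fin n) → ℝ) (hu : ContDiffOn ℝ ∞ u Ω)
    (hu_range : MapsTo u Ω J)
    (hu_convex : IsConvexFunctionOn Ω u)
    (hu_eq : ∀ x ∈ Ω, (Δ u) x = G (u x))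
    (hmin : ∃ p ∈ Ω, IsLocalMin (fun x => sigmaK 2 (hessianMatrix u x)) p) :
    ∀ x ∈ Ω, (hessianMatrix u x).rank = 1 := by
  have hposΩ : ∀ x ∈ Ω, 0 < G (u x) := fun x hx => hG_pos _ (hu_range hx)
  set F : EuclideanSpace ℝ (Fin n) → ℝ := fun x => sigmaK 2 (hessianMatrix u x)
  have hh : ContDiffOn ℝ ∞ (fun y => G (u y)) Ω := hG.comp hu hu_range
  have hFs : ContDiffOn ℝ ∞ F Ω := contDiffOn_sigmaK_two hΩ_open hu hh hu_eq
  have hFnn : ∀ x ∈ Ω, 0 ≤ F x := fun x hx =>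
    sigmaK_two_hessianMatrix_nonneg hΩ_open hu hu_convex hx
  have hineq : ∀ x ∈ Ω, (Δ F) x ≤ 2 * deriv G (u x) * F x
      + 8 * n * ‖fderiv ℝ (fun y => G (u y)) x‖ / G (u x) * ‖fderiv ℝ F x‖ := fun x hx =>
    laplacian_sigmaK_two_le hΩ_open hu hu_convex hJ hG hu_range hA hu_eq hx (hposΩ x hx)
      (hG_struct _ (hu_range hx))
  -- a local minimum with positive value is excluded, since there `ΔF ≤ 2 G' F < 0`
  obtain ⟨p, hp, hpmin⟩ := hmin
  have hFp : F p = 0 := by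
    by_contra hne
    have hFpos : 0 < F p := lt_of_le_of_ne (hFnn p hp) (Ne.symm hne)
    have h1 := hineq p hp
    rw [hpmin.fderiv_eq_zero, norm_zero, mul_zero, add_zero] at h1
    have h2 : 0 ≤ (Δ F) p := by
      rw [laplacian_eq_sum_dirDeriv (EuclideanSpace.basisFun (Fin n) ℝ) hΩ_open hFs hp]
      exact Finset.sum_nonneg fun i _ => hpmin.dirDeriv_dirDeriv_nonneg hΩ_open hFs hp _
    have h3 := mul_neg_of_neg_of_pos (hG_deriv _ (hu_range hp)) hFpos
    linarith
  -- the zero set of `F` is open in `Ω` by the strong minimum principle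
  have hstrong : ∀ q ∈ Ω, F q = 0 → ∀ᶠ z in nhds q, F z = 0 := by
    intro q hq hFq
    set c : EuclideanSpace ℝ (Fin n) → ℝ :=
      fun x => 8 * n * ‖fderiv ℝ (fun y => G (u y)) x‖ / G (u x)
    have hc : ContinuousOn c Ω := by
      have h1 : ContinuousOn (fderiv ℝ (fun y => G (u y))) Ω :=
        hh.continuousOn_fderiv_of_isOpen hΩ_open (by simp)
      exact (continuousOn_const.mul h1.norm).div hh.continuousOn fun x hx => (hposΩ x hx).ne'
    have hcq : ∀ᶠ z in nhds q, c z < c q + 1 :=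
      (hc.continuousAt (hΩ_open.mem_nhds hq)).eventually_lt_const (by linarith)
    obtain ⟨r, hr, hrs⟩ := Metric.eventually_nhds_iff_ball.1
      (hcq.and (hΩ_open.eventually_mem hq))
    refine eventually_eq_zero_of_laplacian_le (Ω := Metric.ball q r) (C := c q + 1)
      Metric.isOpen_ball (hFs.mono fun z hz => (hrs z hz).2) (fun z hz => hFnn z (hrs z hz).2)
      (fun z hz => ?_) (Metric.mem_ball_self hr) hFq
    obtain ⟨hz1, hz2⟩ := hrs z hz
    have h1 := hineq z hz2
    have h2 : 2 * deriv G (u z) * F z ≤ 0 := by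
      have := mul_nonpos_of_nonpos_of_nonneg (hG_deriv _ (hu_range hz2)).le (hFnn z hz2)
      linarith
    have h3 := mul_le_mul_of_nonneg_right hz1.le (norm_nonneg (fderiv ℝ F z))
    simp only [c] at h3
    linarith
  have hsub : Ω ⊆ {x | ∀ᶠ z in nhds x, F z = 0} := by
    refine hΩ_conn.isPreconnected.subset_of_closure_inter_subset isOpen_setOfPred_eventually_nhds
      ⟨p, hp, hstrong p hp hFp⟩ fun x ⟨hxc, hx⟩ => hstrong x hx ?_
    by_contra hne
    have hev := (hFs.continuousOn.continuousAt (hΩ_open.mem_nhds hx)).eventually_ne hne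
    obtain ⟨z, hz1, hz2⟩ := (mem_closure_iff_nhds.1 hxc _ hev)
    exact hz1 hz2.self_of_nhds
  intro x hx
  exact rank_hessianMatrix_eq_one hΩ_open hu hu_convex hx (hu_eq x hx ▸ hposΩ x hx)
    (hsub hx).self_of_nhds
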